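/- Let $\Gamma=SL_2(\mathbb{Z})$, let $M_k(\Gamma)$ be the space of modular forms of weight $k$ on $\Gamma$, and let $E_2(\tau)=1-24\sum_{n\ge 1}\sigma_1(n)q^n$, $q=e^{2\pi i\tau}$. For integers $w\ge 0$ and $r$, let $QM_w^{(r)}$ be the space of quasimodular forms of weight $w$ and depth $\le r$ on $\Gamma$, that is, of all functions $\sum_{0\le \ell\le r}E_2^{\ell}f_\ell$ with $f_\ell\in M_{w-2\ell}(\Gamma)$ (so $QM_w^{(0)}=M_w(\Gamma)$). A form $f=\sum_{n\ge 0}a_nq^n\in QM_w^{(1)}\setminus QM_w^{(0)}$ is called a normalized extremal quasimodular form of weight $w$ and depth $1$ if its vanishing order at $q=0$ is $m-1$ and $a_{m-1}=1$, where $m=\dim_{\mathbb{C}}QM_w^{(1)}$. For every even integer $w\ge 2$ with $w\ne 4$ there is exactly one normalized extremal quasimodular form $G_w^{(1)}$ of weight $w$ and depth $1$ on $\Gamma$. Moreover, for every integer $w\ge 0$, every Fourier coefficient of every normalized extremal quasimodular form of weight $w$ and depth $1$ on $\Gamma$ is a rational number whose denominator (in lowest terms) is divisible only by primes $p<w$.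 -/

import Mathlib

open UpperHalfPlane EisensteinSeries
open scoped MatrixGroups

/-- `QM_w^{(r)}`: the space of quasimodular forms of weight `w` and depth `≤ r` on `SL(2, ℤ)`, i.e.
the functions `∑_{0 ≤ ℓ ≤ r} E₂ ^ ℓ f_ℓ` on the upper half plane with `f_ℓ` a modular form of weight
`w - 2ℓ` on `SL(2, ℤ)`. It is zero for `r < 0`. -/
noncomputable def quasimodularForms (w r : ℤ) : Submodule ℂ (ℍ → ℂ) :=
  Submodule.span ℂ {f | ∃ (l : ℕ) (g : ModularForm 𝒮ℒ (w - 2 * (l : ℤ))),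
    (l : ℤ) ≤ r ∧ f = E2 ^ l * (g : ℍ → ℂ)}

/-- The `n`-th Fourier coefficient at infinity, with `q = e ^ (2πiτ)`. -/
noncomputable def fourierCoeff₁ (f : ℍ → ℂ) (n : ℕ) : ℂ :=
  (qExpansion 1 f).coeff n

/-- `f` is an extremal quasimodular form of weight `w` and depth (exactly) `r`: its vanishing order
in `q` is `m - 1`, where `m = dim QM_w^{(r)}`. Here `m ≥ 1`, as `f ≠ 0`. -/
def IsExtremalQuasimodular (w r : ℤ) (f : ℍ → ℂ) : Prop :=
  f ∈ quasimodularForms w r ∧ f ∉ quasimodularForms w (r - 1) ∧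
    (qExpansion 1 f).order = ((Module.finrank ℂ (quasimodularForms w r) - 1 : ℕ) : ℕ∞)

/-- `f` is extremal and its leading Fourier coefficient `a_{m-1}` is `1`. -/
def IsNormalizedExtremalQuasimodular (w r : ℤ) (f : ℍ → ℂ) : Prop :=
  IsExtremalQuasimodular w r f ∧
    fourierCoeff₁ f (Module.finrank ℂ (quasimodularForms w r) - 1) = 1

/-! Write `w = 2k`. The monomials `E₂^ε E₄^a E₆^b` of weight `w` with `ε ≤ 1` span the space, one
for each `b ≤ k/3`, and have integral `q`-expansions. Let `M` be the square integer matrix of their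
first `k/3 + 1` Fourier coefficients. The coordinates of a normalized extremal form solve `M x = (0,
…, 0, 1)`, so `det M ≠ 0` gives the dimension and uniqueness, and solving the system gives existence
(weight 4 fails because the solution `E₄` has depth 0). By Cramer's rule `det M` clears every
denominator. It remains to show that no prime `p ≥ w` divides `det M`.

A kernel vector of `M` over a field `K` is a form `f = A + E₂ B`, with `A`, `B` formal polynomials
in `E₄`, `E₆`, vanishing to order `n > k/3` (`eq_zero_of_dvd_quasimodular`). Eliminating `E₂`
between `f` and a Serre-type derivative of `f` gives a form of weight `2w` with the same vanishing,
which is zero by the valence bound (`IsForm.eq_zero_of_order`). This says that `h = A/B` solves the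
Riccati equation `12 ϑh = h² + E₄`. In lowest terms `h = a/b`, the absence of forms of weight 2
forces `a = -12 ϑb`, and hence `144 ϑ²b + E₄ b = 0` (`eq_zero_of_riccati`). If `b` has weight `2j`
and order `n`, its leading coefficient is annihilated by `(2j + 1 - 12n)²`; here `1 ≤ 2j + 1 - 12n ≤
w - 1`, which is invertible in characteristic 0 or `p ≥ w` (`eq_zero_of_serre_serre`).

Only Ramanujan's equations and the constant terms enter, along with `E₄³ - E₆² = 1728q + ⋯`, so the
argument runs over `ZMod p` and over `ℚ` alike. -/

namespace MvPolynomial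

/-! ### Factors of weighted homogeneous polynomials -/

section HomogeneousFactor

variable {σ R : Type*} [CommRing R] (w : σ → ℕ)

/-- The grading of `MvPolynomial σ R` by the weights `w`, as a homomorphism to polynomials. -/
noncomputable def weightGrading : MvPolynomial σ R →ₐ[R] Polynomial (MvPolynomial σ R) :=
  aeval fun i ↦ Polynomial.C (X i) * Polynomial.X ^ w i

lemma weightGrading_monomial (d : σ →₀ ℕ) (c : R) :
    weightGrading w (monomial d c) =
      Polynomial.C (monomial d c) * Polynomial.X ^ (Finsupp.weight w d) := by
  rw [weightGrading, aeval_monomial, monomial_eq, map_mul, Finsupp.prod, Finsupp.prod, map_prod]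
  simp only [mul_pow, Finset.prod_mul_distrib, ← pow_mul, Finset.prod_pow_eq_pow_sum, map_pow]
  rw [mul_assoc]
  congr 2
  rw [Finsupp.weight_apply, Finsupp.sum]
  simp [mul_comm]

lemma coeff_weightGrading (n : ℕ) (F : MvPolynomial σ R) :
    (weightGrading w F).coeff n = weightedHomogeneousComponent w n F := by
  classical
  induction F using MvPolynomial.induction_on' with
  | monomial d c =>
    rw [weightGrading_monomial, Polynomial.coeff_C_mul_X_pow]
    ext e
    rw [coeff_weightedHomogeneousComponent]
    by_cases h : n = Finsupp.weight w d <;> by_cases h' : d = e <;> simp_all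
    all_goals grind
  | add p q hp hq => simp [hp, hq]

lemma IsWeightedHomogeneous.weightGrading_eq {n : ℕ} {F : MvPolynomial σ R}
    (hF : IsWeightedHomogeneous w F n) :
    weightGrading w F = Polynomial.C F * Polynomial.X ^ n := by
  ext1 m
  rw [coeff_weightGrading, Polynomial.coeff_C_mul_X_pow]
  split_ifs with h
  · rw [h, hF.weightedHomogeneousComponent_same]
  · exact hF.weightedHomogeneousComponent_ne _ h

lemma isWeightedHomogeneous_of_coeff_weightGrading {n : ℕ} {F : MvPolynomial σ R}
    (h : ∀ m ≠ n, (weightGrading w F).coeff m = 0) : IsWeightedHomogeneous w F n := by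
  classical
  intro d hd
  by_contra hne
  apply hd
  have := congrArg (coeff d) (h _ hne)
  rwa [coeff_weightGrading, coeff_weightedHomogeneousComponent, if_pos rfl, coeff_zero] at this

lemma weightGrading_ne_zero {F : MvPolynomial σ R} (hF : F ≠ 0) : weightGrading w F ≠ 0 := by
  classical
  obtain ⟨d, hd⟩ := ne_zero_iff.mp hF
  intro h
  apply hd
  have := congrArg (coeff d) (congrArg (Polynomial.coeff · (Finsupp.weight w d)) h)
  simpa [coeff_weightGrading, coeff_weightedHomogeneousComponent] using this

lemma isWeightedHomogeneous_of_natDegree_le {F : MvPolynomial σ R}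
    (h : (weightGrading w F).natDegree ≤ (weightGrading w F).natTrailingDegree) :
    IsWeightedHomogeneous w F (weightGrading w F).natDegree := by
  apply isWeightedHomogeneous_of_coeff_weightGrading
  intro m hm
  rcases lt_or_gt_of_ne hm with hm | hm
  · exact Polynomial.coeff_eq_zero_of_lt_natTrailingDegree (hm.trans_le h)
  · exact Polynomial.coeff_eq_zero_of_natDegree_lt hm

/-- Factors of a nonzero weighted homogeneous polynomial are weighted homogeneous. -/
theorem IsWeightedHomogeneous.factors [IsDomain R] {n : ℕ} {F G : MvPolynomial σ R}
    (h : IsWeightedHomogeneous w (F * G) n) (h0 : F * G ≠ 0) :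
    ∃ i j, i + j = n ∧ IsWeightedHomogeneous w F i ∧ IsWeightedHomogeneous w G j := by
  have hF := weightGrading_ne_zero w (left_ne_zero_of_mul h0)
  have hG := weightGrading_ne_zero w (right_ne_zero_of_mul h0)
  -- The image of the product is a single power of the grading variable. Degree and trailing degree
  -- add over a domain, so they must agree on each factor as well.
  have e := h.weightGrading_eq
  rw [map_mul] at e
  have e1 := congrArg Polynomial.natDegree e
  have e2 := congrArg Polynomial.natTrailingDegree e
  rw [Polynomial.natDegree_mul hF hG, Polynomial.natDegree_C_mul_X_pow _ _ h0] at e1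
  rw [Polynomial.natTrailingDegree_mul hF hG, Polynomial.C_mul_X_pow_eq_monomial,
    Polynomial.natTrailingDegree_monomial h0] at e2
  have b1 := Polynomial.natTrailingDegree_le_natDegree (weightGrading w F)
  have b2 := Polynomial.natTrailingDegree_le_natDegree (weightGrading w G)
  exact ⟨_, _, e1, isWeightedHomogeneous_of_natDegree_le w (by omega),
    isWeightedHomogeneous_of_natDegree_le w (by omega)⟩

end HomogeneousFactor

end MvPolynomial

-- Adding `r` to both weights avoids truncated subtraction: if `k < w i`, the variable `i` does not
-- occur in `F` and the derivative is zero.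
open MvPolynomial in
lemma MvPolynomial.IsWeightedHomogeneous.pderiv_mul {σ R : Type*} [CommRing R] {w : σ → ℕ}
    {F G : MvPolynomial σ R} {k r : ℕ} {i : σ} (hF : IsWeightedHomogeneous w F k)
    (hG : IsWeightedHomogeneous w G (w i + r)) :
    IsWeightedHomogeneous w (pderiv i F * G) (k + r) := by
  by_cases h : w i ≤ k
  · have := (hF.pderiv (i := i) (Nat.sub_add_cancel h)).mul hG
    rwa [← add_assoc, Nat.sub_add_cancel h] at this
  · have : pderiv i F = 0 := by
      ext d
      rw [coeff_pderiv, hF.coeff_eq_zero, zero_mul, coeff_zero]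
      rw [map_add, Finsupp.weight_single]
      simp
      omega
    rw [this, zero_mul]
    exact isWeightedHomogeneous_zero _ _ _

/-! ### Formal modular forms over a field, and the valence bound -/

/-- Power series `P`, `Q`, `R` which satisfy Ramanujan's differential equations and behave like
`E₂`, `E₄`, `E₆` at `q = 0`. -/
structure RamanujanTriple (K : Type*) [Field K] where
  P : PowerSeries K
  Q : PowerSeries K
  R : PowerSeries K
  derivative_P : 12 * (PowerSeries.X * PowerSeries.derivative K P) = P ^ 2 - Q
  derivative_Q : 3 * (PowerSeries.X * PowerSeries.derivative K Q) = P * Q - R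
  derivative_R : 2 * (PowerSeries.X * PowerSeries.derivative K R) = P * R - Q ^ 2
  coeff_zero_P : P.constantCoeff = 1
  coeff_zero_Q : Q.constantCoeff = 1
  coeff_zero_R : R.constantCoeff = 1
  coeff_one_ne_zero : PowerSeries.coeff 1 (Q ^ 3 - R ^ 2) ≠ 0
  two_ne_zero : (2 : K) ≠ 0
  three_ne_zero : (3 : K) ≠ 0

namespace RamanujanTriple

variable {K : Type*} [Field K] (T : RamanujanTriple K)

open MvPolynomial

/-- Half the weights of `E₄` and `E₆`. -/
abbrev halfWeight : Fin 2 → ℕ := ![2, 3]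

/-- `F` is a weighted homogeneous polynomial in `E₄`, `E₆` of weight `2 * k`. -/
abbrev IsForm (F : MvPolynomial (Fin 2) K) (k : ℕ) : Prop :=
  IsWeightedHomogeneous halfWeight F k

/-- The expansion of a polynomial in `E₄`, `E₆`. -/
noncomputable def expansion : MvPolynomial (Fin 2) K →ₐ[K] PowerSeries K := aeval ![T.Q, T.R]

/-- The Serre derivative on polynomials in `E₄`, `E₆`. -/
noncomputable def serre : Derivation K (MvPolynomial (Fin 2) K) (MvPolynomial (Fin 2) K) :=
  (-C (3⁻¹ : K) * X 1 : MvPolynomial (Fin 2) K) • pderiv 0 +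
    (-C (2⁻¹ : K) * X 0 ^ 2 : MvPolynomial (Fin 2) K) • pderiv 1

/-- The derivation `q d/dq`. -/
noncomputable def thetaOp : Derivation K (PowerSeries K) (PowerSeries K) :=
  (PowerSeries.X : PowerSeries K) • PowerSeries.derivative K

lemma thetaOp_apply (f : PowerSeries K) :
    thetaOp f = PowerSeries.X * PowerSeries.derivative K f := rfl

lemma coeff_thetaOp (f : PowerSeries K) (n : ℕ) :
    PowerSeries.coeff n (thetaOp f) = n * PowerSeries.coeff n f := by
  rw [thetaOp_apply]
  cases n with
  | zero => simp
  | succ n => rw [PowerSeries.coeff_succ_X_mul, PowerSeries.coeff_derivative]; push_cast; ring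

lemma serre_eq (F : MvPolynomial (Fin 2) K) :
    serre F = pderiv 0 F * (-C (3⁻¹ : K) * X 1) + pderiv 1 F * (-C (2⁻¹ : K) * X 0 ^ 2) := by
  simp [serre, mul_comm]

lemma isForm_X_zero : IsForm (X 0 : MvPolynomial (Fin 2) K) 2 := isWeightedHomogeneous_X _ _ _
lemma isForm_X_one : IsForm (X 1 : MvPolynomial (Fin 2) K) 3 := isWeightedHomogeneous_X _ _ _

lemma IsForm.serre {F : MvPolynomial (Fin 2) K} {k : ℕ} (hF : IsForm F k) :
    IsForm (serre F) (k + 1) := by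
  rw [serre_eq]
  refine IsWeightedHomogeneous.add (hF.pderiv_mul ?_) (hF.pderiv_mul ?_)
  · rw [← C_neg]; exact isForm_X_one.C_mul _
  · rw [← C_neg]; exact (isForm_X_zero.pow 2).C_mul _

@[simp] lemma expansion_X_zero : T.expansion (X 0) = T.Q := by simp [expansion]
@[simp] lemma expansion_X_one : T.expansion (X 1) = T.R := by simp [expansion]
@[simp] lemma expansion_C (c : K) : T.expansion (C c) = PowerSeries.C c := by
  rw [expansion, aeval_C]; rfl

lemma six_ne_zero (T : RamanujanTriple K) : (6 : K) ≠ 0 := by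
  rw [show (6 : K) = 2 * 3 by norm_num]; exact mul_ne_zero T.two_ne_zero T.three_ne_zero

lemma thetaOp_Q : thetaOp T.Q = PowerSeries.C (3⁻¹ : K) * (T.P * T.Q - T.R) := by
  rw [← T.derivative_Q, ← mul_assoc, show (3 : PowerSeries K) = PowerSeries.C 3 from (map_ofNat _ 3).symm, ← map_mul,
    inv_mul_cancel₀ T.three_ne_zero, map_one, one_mul, thetaOp_apply]

lemma thetaOp_R : thetaOp T.R = PowerSeries.C (2⁻¹ : K) * (T.P * T.R - T.Q ^ 2) := by
  rw [← T.derivative_R, ← mul_assoc, show (2 : PowerSeries K) = PowerSeries.C 2 from (map_ofNat _ 2).symm, ← map_mul,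
    inv_mul_cancel₀ T.two_ne_zero, map_one, one_mul, thetaOp_apply]

/-- Both sides obey the Leibniz rule in `F`, so Ramanujan's equations on the generators suffice. The
sum is the weighted Euler operator; keeping it makes the induction possible without homogeneity. -/
lemma thetaOp_expansion_aux (F : MvPolynomial (Fin 2) K) :
    thetaOp (T.expansion F) = T.expansion (serre F) + PowerSeries.C (6⁻¹ : K) * T.P *
      T.expansion (∑ i, halfWeight i • (X i * pderiv i F)) := by
  have e2 : (PowerSeries.C (2⁻¹ : K)) = PowerSeries.C (6⁻¹ : K) * 3 := by
    rw [show (3 : PowerSeries K) = PowerSeries.C 3 from (map_ofNat _ 3).symm, ← map_mul]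
    congr 1
    have := T.two_ne_zero; have := T.three_ne_zero; have := T.six_ne_zero
    field_simp; norm_num
  have e3 : (PowerSeries.C (3⁻¹ : K)) = PowerSeries.C (6⁻¹ : K) * 2 := by
    rw [show (2 : PowerSeries K) = PowerSeries.C 2 from (map_ofNat _ 2).symm, ← map_mul]
    congr 1
    have := T.two_ne_zero; have := T.three_ne_zero; have := T.six_ne_zero
    field_simp; norm_num
  have hC (c : K) : thetaOp (PowerSeries.C c) = 0 := by simp [thetaOp_apply]
  simp only [Fin.sum_univ_two, serre_eq, halfWeight]
  induction F using MvPolynomial.induction_on with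
  | C a => simp [hC]
  | add p q hp hq =>
    simp only [map_add, hp, hq, add_mul, mul_add, smul_add]
    ring
  | mul_X p i hp =>
    rw [map_mul, Derivation.leibniz, hp]
    fin_cases i <;>
    simp [thetaOp_Q, thetaOp_R, e2, e3, pderiv_X, Derivation.leibniz, map_ofNat T.expansion] <;> ring

lemma thetaOp_expansion {F : MvPolynomial (Fin 2) K} {k : ℕ} (hF : IsForm F k) :
    thetaOp (T.expansion F) = T.expansion (serre F) +
      PowerSeries.C (k / 6 : K) * T.P * T.expansion F := by
  rw [thetaOp_expansion_aux, hF.sum_weight_X_mul_pderiv, map_nsmul, nsmul_eq_mul]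
  congr 1
  rw [div_eq_mul_inv, map_mul, map_natCast]
  ring

/-- There are no forms of weight 2, since `2a + 3b ≠ 1`. -/
lemma IsForm.eq_zero_of_one {F : MvPolynomial (Fin 2) K} (hF : IsForm F 1) : F = 0 := by
  ext d
  rw [coeff_zero]
  apply hF.coeff_eq_zero
  rw [Finsupp.weight_apply, Finsupp.sum_fintype _ _ (by simp)]
  simp
  omega

/-- Monomials of the same weight are congruent modulo `E₄ ^ 3 - E₆ ^ 2`. -/
lemma dvd_monomial_sub {d e : Fin 2 →₀ ℕ}
    (h : Finsupp.weight halfWeight d = Finsupp.weight halfWeight e) :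
    (X 0 ^ 3 - X 1 ^ 2 : MvPolynomial (Fin 2) K) ∣ monomial d 1 - monomial e 1 := by
  wlog hle : e 0 ≤ d 0 generalizing d e
  · rw [← neg_sub (monomial e 1), dvd_neg]
    exact this h.symm (by omega)
  rw [Finsupp.weight_apply, Finsupp.sum_fintype _ _ (by simp), Finsupp.weight_apply,
    Finsupp.sum_fintype _ _ (by simp)] at h
  simp at h
  -- From `2 d₀ + 3 d₁ = 2 e₀ + 3 e₁`, the difference `d₀ - e₀` is a multiple of 3.
  obtain ⟨t, ht⟩ : ∃ t, d 0 = e 0 + 3 * t := ⟨(d 0 - e 0) / 3, by omega⟩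
  have ht' : e 1 = d 1 + 2 * t := by omega
  simp only [monomial_eq, Finsupp.prod_fintype, pow_zero, implies_true, Fin.prod_univ_two, map_one,
    one_mul, ht, ht', pow_add, pow_mul]
  rw [show (X 0 ^ e 0 * (X 0 ^ 3) ^ t * X 1 ^ d 1 - X 0 ^ e 0 * (X 1 ^ d 1 * (X 1 ^ 2) ^ t) :
    MvPolynomial (Fin 2) K) = X 0 ^ e 0 * X 1 ^ d 1 * ((X 0 ^ 3) ^ t - (X 1 ^ 2) ^ t) by ring]
  exact (sub_dvd_pow_sub_pow _ _ _).mul_left _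

lemma constantCoeff_expansion_monomial (d : Fin 2 →₀ ℕ) (c : K) :
    (T.expansion (monomial d c)).constantCoeff = c := by
  rw [monomial_eq, Finsupp.prod_fintype _ _ (by simp)]
  simp [T.coeff_zero_Q, T.coeff_zero_R]

lemma constantCoeff_expansion (F : MvPolynomial (Fin 2) K) :
    (T.expansion F).constantCoeff = ∑ d ∈ F.support, coeff d F := by
  conv_lhs => rw [F.as_sum]
  rw [map_sum, map_sum]
  exact Finset.sum_congr rfl fun d _ ↦ T.constantCoeff_expansion_monomial d _

/-- A form which vanishes at the cusp is divisible by `E₄ ^ 3 - E₆ ^ 2`. -/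
lemma IsForm.dvd {F : MvPolynomial (Fin 2) K} {k : ℕ} (hF : IsForm F k)
    (h : (T.expansion F).constantCoeff = 0) : (X 0 ^ 3 - X 1 ^ 2 : MvPolynomial (Fin 2) K) ∣ F := by
  rcases eq_or_ne F 0 with rfl | h0
  · exact dvd_zero _
  obtain ⟨e, he⟩ := ne_zero_iff.mp h0
  -- Every monomial has constant term 1, so the coefficients of `F` sum to zero and one fixed
  -- monomial may be subtracted from all of them.
  have : F = ∑ d ∈ F.support, C (coeff d F) * (monomial d 1 - monomial e 1) := by
    simp only [mul_sub, C_mul_monomial, mul_one, Finset.sum_sub_distrib]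
    rw [← map_sum (monomial e), ← T.constantCoeff_expansion, h, map_zero, sub_zero, ← F.as_sum]
  rw [this]
  refine Finset.dvd_sum fun d hd ↦ (dvd_monomial_sub ?_).mul_left _
  rw [hF (mem_support_iff.mp hd), hF he]

lemma isForm_discriminant : IsForm (X 0 ^ 3 - X 1 ^ 2 : MvPolynomial (Fin 2) K) 6 :=
  (isForm_X_zero.pow 3).sub (isForm_X_one.pow 2)

lemma expansion_discriminant : ∃ u : PowerSeries K, u.constantCoeff ≠ 0 ∧
    T.expansion (X 0 ^ 3 - X 1 ^ 2) = PowerSeries.X * u := by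
  have h : (T.Q ^ 3 - T.R ^ 2).constantCoeff = 0 := by simp [T.coeff_zero_Q, T.coeff_zero_R]
  obtain ⟨u, hu⟩ := PowerSeries.X_dvd_iff.mpr h
  refine ⟨u, ?_, by simpa using hu⟩
  have := T.coeff_one_ne_zero
  rw [hu, show 1 = 0 + 1 from rfl, PowerSeries.coeff_succ_X_mul] at this
  simpa using this

/-- The valence bound for forms. -/
theorem IsForm.eq_zero_of_order {F : MvPolynomial (Fin 2) K} {k n : ℕ} (hF : IsForm F k)
    (hn : k < 6 * n) (h : PowerSeries.X ^ n ∣ T.expansion F) : F = 0 := by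
  induction n generalizing F k with
  | zero => omega
  | succ n ih =>
    obtain ⟨G, rfl⟩ := hF.dvd T (by
      rw [← PowerSeries.X_dvd_iff]
      exact (dvd_pow_self _ n.succ_ne_zero).trans h)
    by_contra h0
    obtain ⟨i, j, hij, hi, hj⟩ := IsWeightedHomogeneous.factors _ hF h0
    -- Dividing by the discriminant lowers the half-weight by 6 and the order by 1.
    obtain rfl := isForm_discriminant.inj_right (left_ne_zero_of_mul h0) hi
    obtain ⟨u, hu, hΔ⟩ := T.expansion_discriminant
    rw [map_mul, hΔ, pow_succ', mul_assoc] at h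
    have h1 := (mul_dvd_mul_iff_left PowerSeries.X_ne_zero).mp h
    have hunit : IsUnit u := by
      rw [PowerSeries.isUnit_iff_constantCoeff]; exact hu.isUnit
    refine right_ne_zero_of_mul h0 (ih hj (by omega) ?_)
    exact (hunit.dvd_mul_left).mp h1

end RamanujanTriple

/-! ### Nonvanishing in depth one: Wronskian, Riccati equation, indicial equation -/

namespace RamanujanTriple

variable {K : Type*} [Field K] (T : RamanujanTriple K)

open MvPolynomial

lemma coeff_mul_of_dvd {f g : PowerSeries K} {n : ℕ} (h : PowerSeries.X ^ n ∣ g) :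
    PowerSeries.coeff n (f * g) = f.constantCoeff * PowerSeries.coeff n g := by
  obtain ⟨u, rfl⟩ := h
  rw [mul_left_comm]
  have (v : PowerSeries K) : PowerSeries.coeff n (PowerSeries.X ^ n * v) = v.constantCoeff := by
    simpa using PowerSeries.coeff_X_pow_mul v n 0
  rw [this, this, map_mul]

lemma dvd_thetaOp {f : PowerSeries K} {n : ℕ} (h : PowerSeries.X ^ n ∣ f) :
    PowerSeries.X ^ n ∣ thetaOp f := by
  rw [PowerSeries.X_pow_dvd_iff] at h ⊢
  intro m hm
  rw [coeff_thetaOp, h m hm, mul_zero]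

lemma expansion_serre {F : MvPolynomial (Fin 2) K} {k : ℕ} (hF : IsForm F k) :
    T.expansion (serre F) = thetaOp (T.expansion F) -
      PowerSeries.C (k / 6 : K) * T.P * T.expansion F := by
  rw [T.thetaOp_expansion hF, add_sub_cancel_right]

lemma dvd_expansion_serre {F : MvPolynomial (Fin 2) K} {k n : ℕ} (hF : IsForm F k)
    (h : PowerSeries.X ^ n ∣ T.expansion F) : PowerSeries.X ^ n ∣ T.expansion (serre F) := by
  rw [T.expansion_serre hF]
  exact dvd_sub (dvd_thetaOp h) (h.mul_left _)

/-- On the leading term `q d/dq` acts as `n` and `E₂` as 1. Applied twice, this yields the indicial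
polynomial. -/
lemma coeff_expansion_serre {F : MvPolynomial (Fin 2) K} {k n : ℕ} (hF : IsForm F k)
    (h : PowerSeries.X ^ n ∣ T.expansion F) :
    PowerSeries.coeff n (T.expansion (serre F)) =
      (n - k / 6) * PowerSeries.coeff n (T.expansion F) := by
  rw [T.expansion_serre hF, map_sub, coeff_thetaOp, coeff_mul_of_dvd h, map_mul, T.coeff_zero_P,
    PowerSeries.constantCoeff_C]
  ring

/-- A form of weight `2 * j` that solves `144 ϑ² b + E₄ b = 0` vanishes if the nonzero integers up to
`2 * j + 1` are invertible: the indicial equation of the differential equation has the double root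
`(2 * j + 1) / 12`. -/
lemma eq_zero_of_serre_serre (T : RamanujanTriple K) {b : MvPolynomial (Fin 2) K} {j : ℕ} (hb : IsForm b j)
    (h : 144 * serre (serre b) + X 0 * b = 0)
    (hchar : ∀ i : ℕ, 1 ≤ i → i ≤ 2 * j + 1 → (i : K) ≠ 0) : b = 0 := by
  classical
  by_contra h0
  have hne : T.expansion b ≠ 0 := fun h ↦
    h0 (hb.eq_zero_of_order T (n := j / 6 + 1) (by omega) (h ▸ dvd_zero _))
  obtain ⟨u, hu⟩ := PowerSeries.X_pow_order_dvd (φ := T.expansion b)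
  set n := (T.expansion b).order.toNat with hn
  have hdvd : PowerSeries.X ^ n ∣ T.expansion b := ⟨u, hu⟩
  have hle : 6 * n ≤ j := by
    by_contra hlt
    exact h0 (hb.eq_zero_of_order T (by omega) hdvd)
  have hβ : PowerSeries.coeff n (T.expansion b) ≠ 0 := PowerSeries.coeff_order hne
  have e := congrArg (fun F ↦ PowerSeries.coeff n (T.expansion F)) h
  simp only [map_add, map_mul, expansion_X_zero, map_ofNat, map_zero] at e
  rw [coeff_mul_of_dvd hdvd, T.coeff_zero_Q,
    coeff_mul_of_dvd (T.dvd_expansion_serre hb.serre (T.dvd_expansion_serre hb hdvd)),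
    T.coeff_expansion_serre hb.serre (T.dvd_expansion_serre hb hdvd),
    T.coeff_expansion_serre hb hdvd, map_ofNat] at e
  have h6 := T.six_ne_zero
  -- The indicial polynomial is a perfect square: `144 (n - (j + 1)/6)(n - j/6) + 1 = (12n - 2j -
  -- 1)²`. The natural subtraction is harmless because `6n ≤ j`.
  have e' : ((2 * j + 1 - 12 * n : ℕ) : K) ^ 2 * PowerSeries.coeff n (T.expansion b) = 0 := by
    rw [← e, Nat.cast_sub (by omega)]
    push_cast
    field_simp
    ring
  exact mul_ne_zero (pow_ne_zero 2 (hchar _ (by omega) (by omega))) hβ e'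

/-- The homogeneous form of the Riccati equation `12 ϑ h = h² + E₄` has no nonzero solution of small
weight. -/
lemma eq_zero_of_riccati (T : RamanujanTriple K) {A B : MvPolynomial (Fin 2) K} {m : ℕ} (hA : IsForm A (m + 1))
    (hB : IsForm B m) (h : 12 * (A * serre B - B * serre A) + A ^ 2 + X 0 * B ^ 2 = 0)
    (hchar : ∀ i : ℕ, 1 ≤ i → i ≤ 2 * m + 1 → (i : K) ≠ 0) : A = 0 ∧ B = 0 := by
  have hB0 : B = 0 := by
    by_contra hB0
    obtain ⟨b, a, c, hrel, rfl, rfl⟩ := UniqueFactorizationMonoid.exists_reduced_factors B hB0 A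
    have hc := left_ne_zero_of_mul hB0
    have hb0 := right_ne_zero_of_mul hB0
    obtain ⟨i, j, hij, hci, hbj⟩ := IsWeightedHomogeneous.factors _ hB hB0
    have ha : IsForm a (j + 1) := by
      rcases eq_or_ne (c * a) 0 with h0 | h0
      · rw [(mul_eq_zero.mp h0).resolve_left hc]
        exact isWeightedHomogeneous_zero _ _ _
      · obtain ⟨i', j', hij', hci', haj'⟩ := IsWeightedHomogeneous.factors _ hA h0
        obtain rfl := hci.inj_right hc hci'
        rwa [show j + 1 = j' by omega]
    have e : 12 * (a * serre b - b * serre a) + a ^ 2 + X 0 * b ^ 2 = 0 := by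
      refine (mul_eq_zero_iff_left (pow_ne_zero 2 hc)).mp ?_
      rw [← h]
      simp only [Derivation.leibniz, smul_eq_mul]
      ring
    -- The equation reads `a (a + 12 ϑb) = b (12 ϑa - E₄ b)`, and `a`, `b` are coprime.
    have hdvd : b ∣ a + 12 * serre b := by
      refine hrel.dvd_of_dvd_mul_left (y := a) ⟨12 * serre a - X 0 * b, ?_⟩
      linear_combination e
    obtain ⟨q, hq⟩ := hdvd
    -- A nonzero quotient would be a form of half-weight 1.
    have hq0 : b * q = 0 := by
      by_contra hbq
      have hform : IsForm (b * q) (j + 1) := by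
        rw [← hq, show (12 : MvPolynomial (Fin 2) K) = C 12 from (map_ofNat _ 12).symm]
        exact ha.add ((IsForm.serre hbj).C_mul _)
      obtain ⟨i', j', hij', hbi', hqj'⟩ := IsWeightedHomogeneous.factors _ hform hbq
      obtain rfl := hbj.inj_right hb0 hbi'
      obtain rfl : j' = 1 := by omega
      exact right_ne_zero_of_mul hbq (IsForm.eq_zero_of_one hqj')
    obtain rfl : a = -(12 * serre b) := by
      rw [hq0] at hq
      exact eq_neg_of_add_eq_zero_left hq
    have h12 (F : MvPolynomial (Fin 2) K) : serre (12 * F) = 12 * serre F := by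
      rw [show (12 : MvPolynomial (Fin 2) K) = C 12 from (map_ofNat _ 12).symm, ← smul_eq_C_mul,
        ← smul_eq_C_mul, Derivation.map_smul]
    refine hb0 (T.eq_zero_of_serre_serre hbj ?_ fun i h1 h2 ↦ hchar i h1 (by omega))
    refine (mul_eq_zero_iff_left hb0).mp ?_
    rw [map_neg, h12] at e
    linear_combination e
  subst hB0
  simpa using h

/-- A quasimodular form of depth at most one and weight `2 * (m + 1)` whose vanishing order exceeds
`(m + 1) / 3` vanishes, in characteristic zero or greater than `2 * m + 1`. -/
theorem eq_zero_of_dvd_quasimodular {A B : MvPolynomial (Fin 2) K} {m n : ℕ}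
    (hA : IsForm A (m + 1)) (hB : IsForm B m) (hn : m + 1 < 3 * n)
    (h : PowerSeries.X ^ n ∣ T.expansion A + T.P * T.expansion B)
    (hchar : ∀ i : ℕ, 1 ≤ i → i ≤ 2 * m + 1 → (i : K) ≠ 0) : A = 0 ∧ B = 0 := by
  have h2 := T.two_ne_zero
  have h3 := T.three_ne_zero
  have h6 := T.six_ne_zero
  have h12 : (12 : K) ≠ 0 := by
    rw [show (12 : K) = 2 * 6 by norm_num]; exact mul_ne_zero h2 h6
  set f := T.expansion A + T.P * T.expansion B with hf
  -- With `w = 2(m + 1)`, `A' + P B'` is `θf - ((w - 1)/12) P f`. The factor `w - 1`, rather than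
  -- `w`, cancels the `P²` terms and keeps the depth at most one.
  set A' := serre A - C (12⁻¹ : K) * (X 0 * B) with hA'
  set B' := serre B + C (12⁻¹ : K) * A with hB'
  have hA'form : IsForm A' (m + 2) := by
    refine hA.serre.sub (IsWeightedHomogeneous.C_mul ?_ _)
    rw [show m + 1 + 1 = 2 + m by omega]
    exact isForm_X_zero.mul hB
  have hB'form : IsForm B' (m + 1) := hB.serre.add (hA.C_mul _)
  have hP : thetaOp T.P = PowerSeries.C (12⁻¹ : K) * (T.P ^ 2 - T.Q) := by
    rw [← T.derivative_P, ← mul_assoc,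
      show (12 : PowerSeries K) = PowerSeries.C 12 from (map_ofNat _ 12).symm, ← map_mul,
      inv_mul_cancel₀ h12, map_one, one_mul, thetaOp_apply]
  have hg : thetaOp f - PowerSeries.C ((2 * m + 1) / 12 : K) * T.P * f =
      T.expansion A' + T.P * T.expansion B' := by
    have c1 : PowerSeries.C (((m + 1 : ℕ) : K) / 6) =
        PowerSeries.C ((2 * m + 1) / 12 : K) + PowerSeries.C (12⁻¹ : K) := by
      rw [← map_add]; congr 1; push_cast; field_simp; ring
    have c2 : PowerSeries.C ((m : K) / 6) =
        PowerSeries.C ((2 * m + 1) / 12 : K) - PowerSeries.C (12⁻¹ : K) := by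
      rw [← map_sub]; congr 1; field_simp; ring
    rw [hf, hA', hB', map_add, Derivation.leibniz, T.thetaOp_expansion hA, T.thetaOp_expansion hB,
      hP, c1, c2]
    simp only [map_add, map_sub, map_mul, expansion_C, expansion_X_zero, smul_eq_mul]
    ring
  -- This determinant eliminates `P` while keeping order at least `n`. Its half-weight `2m + 2` is
  -- below `6n`, so the valence bound applies.
  have hdvd : PowerSeries.X ^ n ∣ T.expansion (A * B' - A' * B) := by
    have : T.expansion (A * B' - A' * B) = f * T.expansion B' -
        (T.expansion A' + T.P * T.expansion B') * T.expansion B := by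
      rw [hf]; simp only [map_sub, map_mul]; ring
    rw [this, ← hg]
    exact dvd_sub (h.mul_right _) ((dvd_sub (dvd_thetaOp h) (h.mul_left _)).mul_right _)
  have hW : A * B' - A' * B = 0 := by
    refine IsForm.eq_zero_of_order T (k := 2 * m + 2) (IsWeightedHomogeneous.sub ?_ ?_)
      (by omega) hdvd
    · rw [show 2 * m + 2 = (m + 1) + (m + 1) by ring]; exact hA.mul hB'form
    · rw [show 2 * m + 2 = (m + 2) + m by ring]; exact hA'form.mul hB
  refine T.eq_zero_of_riccati hA hB ?_ hchar
  have hc : (12 : MvPolynomial (Fin 2) K) * C (12⁻¹ : K) = 1 := by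
    rw [show (12 : MvPolynomial (Fin 2) K) = C 12 from (map_ofNat _ 12).symm, ← map_mul,
      mul_inv_cancel₀ h12, map_one]
  rw [hA', hB'] at hW
  linear_combination 12 * hW - (A ^ 2 + X 0 * B ^ 2) * hc

end RamanujanTriple

/-! ### Holomorphic functions at the cusp and their `q`-expansions -/

open scoped Manifold Derivative ModularForm

/-- `f` is holomorphic on the upper half plane, has period `1` and is bounded at infinity. -/
structure IsHolomorphicAtCusp (f : ℍ → ℂ) : Prop where
  periodic : Function.Periodic (f ∘ ofComplex) (1 : ℝ)
  mdiff : MDiff f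
  bdd : IsBoundedAtImInfty f

namespace IsHolomorphicAtCusp

variable {f g : ℍ → ℂ}

lemma analyticAt (hf : IsHolomorphicAtCusp f) : AnalyticAt ℂ (cuspFunction 1 f) 0 :=
  analyticAt_cuspFunction_zero one_pos hf.periodic hf.mdiff hf.bdd

lemma _root_.ModularForm.isHolomorphicAtCusp {k : ℤ} (f : ModularForm 𝒮ℒ k) :
    IsHolomorphicAtCusp f where
  periodic := SlashInvariantFormClass.periodic_comp_ofComplex f one_mem_strictPeriods_SL
  mdiff := ModularFormClass.holo f
  bdd := ModularFormClass.bdd_at_infty f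

lemma of_hasSum {c : ℕ → ℂ} (hf : MDiff f)
    (h : ∀ τ : ℍ, HasSum (fun m ↦ c m • Function.Periodic.qParam 1 τ ^ m) (f τ)) :
    IsHolomorphicAtCusp f where
  periodic w := by
    by_cases! hw : 0 < w.im
    · have h1 : 0 < (w + (1 : ℝ)).im := by simpa using hw
      simp only [Function.comp_apply, ofComplex_apply_of_im_pos h1, ofComplex_apply_of_im_pos hw]
      refine (h _).unique ?_
      convert! h ⟨w, hw⟩ using 4
      simp [Function.Periodic.qParam, mul_add, Complex.exp_add]
    -- Off the upper half plane `ofComplex` takes a constant default value.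
    · have h1 : (w + (1 : ℝ)).im ≤ 0 := by simpa using hw
      simp only [Function.comp_apply, ofComplex_apply_of_im_nonpos h1,
        ofComplex_apply_of_im_nonpos hw]
  mdiff := hf
  bdd := isBoundedAtImInfty_of_hasSum_qExpansion one_pos h

lemma qExpansion_eq {s : PowerSeries ℂ} (hf : IsHolomorphicAtCusp f)
    (h : ∀ τ : ℍ, HasSum (fun m ↦ s.coeff m • Function.Periodic.qParam 1 τ ^ m) (f τ)) :
    qExpansion 1 f = s := by
  ext m
  have h1 := (hasFPowerSeriesOnBall_cuspFunction one_pos hf.analyticAt h).hasFPowerSeriesAt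
  have h2 := h1.eq_formalMultilinearSeries hf.analyticAt.hasFPowerSeriesAt
  have h3 := congrArg (FormalMultilinearSeries.coeff · m) h2
  simp only [FormalMultilinearSeries.coeff_ofScalars] at h3
  rw [h3, qExpansion_coeff]
  ring

lemma zero : IsHolomorphicAtCusp 0 :=
  (0 : ModularForm 𝒮ℒ 0).isHolomorphicAtCusp

lemma one : IsHolomorphicAtCusp 1 :=
  (1 : ModularForm 𝒮ℒ 0).isHolomorphicAtCusp

lemma add (hf : IsHolomorphicAtCusp f) (hg : IsHolomorphicAtCusp g) :
    IsHolomorphicAtCusp (f + g) where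
  periodic := hf.periodic.add hg.periodic
  mdiff := hf.mdiff.add hg.mdiff
  bdd := hf.bdd.add hg.bdd

lemma mul (hf : IsHolomorphicAtCusp f) (hg : IsHolomorphicAtCusp g) :
    IsHolomorphicAtCusp (f * g) where
  periodic := hf.periodic.mul hg.periodic
  mdiff := hf.mdiff.mul hg.mdiff
  bdd := hf.bdd.mul hg.bdd

lemma const_smul (hf : IsHolomorphicAtCusp f) (c : ℂ) : IsHolomorphicAtCusp (c • f) where
  periodic := hf.periodic.smul c
  mdiff := hf.mdiff.const_smul c
  bdd := hf.bdd.const_smul_left c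

lemma neg (hf : IsHolomorphicAtCusp f) : IsHolomorphicAtCusp (-f) := by
  simpa using hf.const_smul (-1)

lemma sub (hf : IsHolomorphicAtCusp f) (hg : IsHolomorphicAtCusp g) :
    IsHolomorphicAtCusp (f - g) := by
  simpa [sub_eq_add_neg] using hf.add hg.neg

lemma pow (hf : IsHolomorphicAtCusp f) (n : ℕ) : IsHolomorphicAtCusp (f ^ n) := by
  induction n with
  | zero => simpa using one
  | succ n ih => rw [pow_succ]; exact ih.mul hf

lemma qExpansion_pow (hf : IsHolomorphicAtCusp f) (n : ℕ) :
    qExpansion 1 (f ^ n) = qExpansion 1 f ^ n := by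
  induction n with
  | zero => simp [qExpansion_one]
  | succ n ih => rw [pow_succ, pow_succ, qExpansion_mul (hf.pow n).analyticAt hf.analyticAt, ih]

lemma sum_smul {ι : Type*} (s : Finset ι) {F : ι → ℍ → ℂ} (hF : ∀ i, IsHolomorphicAtCusp (F i))
    (x : ι → ℂ) : IsHolomorphicAtCusp (∑ i ∈ s, x i • F i) ∧
      qExpansion 1 (∑ i ∈ s, x i • F i) = ∑ i ∈ s, x i • qExpansion 1 (F i) := by
  classical
  induction s using Finset.induction_on with
  | empty => simpa [qExpansion_zero] using zero
  | insert i s hi ih =>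
    rw [Finset.sum_insert hi, Finset.sum_insert hi, ← ih.2]
    refine ⟨((hF i).const_smul _).add ih.1, ?_⟩
    rw [qExpansion_add ((hF i).const_smul _).analyticAt ih.1.analyticAt,
      qExpansion_smul (hF i).analyticAt]

open Real in
-- By the chain rule `D f` is `q` times the derivative of the cusp function, whose Taylor series
-- converges on the whole unit disc.
lemma hasSum_deriv (hf : IsHolomorphicAtCusp f) (τ : ℍ) :
    HasSum (fun m ↦ (RamanujanTriple.thetaOp (qExpansion 1 f)).coeff m •
      Function.Periodic.qParam 1 τ ^ m) (D f τ) := by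
  set c := cuspFunction 1 f with hc
  set q := Function.Periodic.qParam 1 τ with hq
  have hq1 : ‖q‖ < 1 := Function.Periodic.norm_qParam_lt_one one_pos τ.im_pos
  have hd : DifferentiableOn ℂ c (Metric.ball 0 1) :=
    differentiableOn_cuspFunction_ball one_pos hf.periodic hf.mdiff hf.bdd
  have hcomp : f ∘ ofComplex = c ∘ Function.Periodic.qParam 1 := by
    ext w
    exact (Function.Periodic.eq_cuspFunction one_ne_zero hf.periodic w).symm
  have hqd : HasDerivAt (Function.Periodic.qParam 1) (q * (2 * π * Complex.I)) τ := by
    have := (((hasDerivAt_id (τ : ℂ)).const_mul (2 * π * Complex.I)).cexp)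
    have e : Function.Periodic.qParam 1 = fun w ↦ Complex.exp (2 * π * Complex.I * w) := by
      ext w; simp [Function.Periodic.qParam]
    rw [hq, e]
    simpa using this
  have hcd : HasDerivAt c (deriv c q) q :=
    (hd.differentiableAt (Metric.isOpen_ball.mem_nhds (by simpa using hq1))).hasDerivAt
  have hD : D f τ = q * deriv c q := by
    rw [Derivative.normalizedDerivOfComplex, hcomp, (hcd.comp (τ : ℂ) hqd).deriv]
    have := Complex.two_pi_I_ne_zero
    field_simp
  have hs := Complex.hasSum_taylorSeries_on_ball (hd.deriv Metric.isOpen_ball) (z := q)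
    (by simpa using hq1)
  rw [hD, ← hasSum_nat_add_iff' 1]
  simp only [Finset.range_one, Finset.sum_singleton, RamanujanTriple.coeff_thetaOp, Nat.cast_zero,
    zero_mul, zero_smul, sub_zero]
  convert! hs.mul_left q using 2 with m
  rw [qExpansion_coeff, iteratedDeriv_succ', Nat.factorial_succ, sub_zero]
  have : ((m : ℂ) + 1) ≠ 0 := by exact_mod_cast m.succ_ne_zero
  have := Nat.cast_ne_zero (R := ℂ).mpr m.factorial_ne_zero
  push_cast
  simp only [smul_eq_mul, ← hc]
  field_simp
  ring

lemma deriv (hf : IsHolomorphicAtCusp f) : IsHolomorphicAtCusp (D f) :=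
  of_hasSum (Derivative.normalizedDerivOfComplex_mdifferentiable hf.mdiff) hf.hasSum_deriv

lemma qExpansion_deriv (hf : IsHolomorphicAtCusp f) :
    qExpansion 1 (D f) = RamanujanTriple.thetaOp (qExpansion 1 f) :=
  hf.deriv.qExpansion_eq hf.hasSum_deriv

/-- A holomorphic function at the cusp which is invariant under the slash action is a modular
form. -/
def toModularForm {k : ℤ} (hf : IsHolomorphicAtCusp f) (h : ∀ γ : SL(2, ℤ), f ∣[k] γ = f) :
    ModularForm 𝒮ℒ k where
  toFun := f
  slash_action_eq' := fun _ ⟨γ, hγ⟩ ↦ hγ ▸ h γ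
  holo' := hf.mdiff
  bdd_at_cusps' {c} hc := by
    rw [Subgroup.IsArithmetic.isCusp_iff_isCusp_SL2Z] at hc
    rw [OnePoint.isBoundedAt_iff_forall_SL2Z hc]
    intro γ _
    rw [h γ]
    exact hf.bdd

end IsHolomorphicAtCusp

lemma isHolomorphicAtCusp_E2 : IsHolomorphicAtCusp E2 :=
  .of_hasSum E2_mdifferentiable fun τ ↦ by
    simpa only [Function.Periodic.qParam, Complex.ofReal_one, div_one] using
      hasSum_qExpansion_E2 (z := τ)

/-! ### Ramanujan's differential equations for the Eisenstein series -/

open ModularForm (E₄ E₆)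

/-- A modular form of weight less than `12` is determined by its constant term. -/
lemma ModularForm.qExpansion_eq_of_weight_lt_twelve {k : ℕ} (hk : k < 12)
    (f g : ModularForm 𝒮ℒ (k : ℤ))
    (h : (qExpansion 1 f).coeff 0 = (qExpansion 1 g).coeff 0) :
    qExpansion 1 f = qExpansion 1 g := by
  have : f - g = 0 := by
    apply sturm_bound_levelOne_nat
    rw [Nat.div_eq_of_lt hk, Nat.cast_zero, pos_iff_ne_zero]
    intro h0
    have := (PowerSeries.order_eq_nat (n := 0)).mp (by simpa using h0)
    apply this.1
    rw [ModularForm.qExpansion_sub one_pos one_mem_strictPeriods_SL, map_sub, h,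
      sub_self]
  rw [sub_eq_zero.mp this]

/-- The function which measures the failure of `E₂` to be modular. -/
noncomputable def E2Cocycle (γ : SL(2, ℤ)) (z : ℍ) : ℂ :=
  (2 * Real.pi * Complex.I)⁻¹ * (γ 1 0 / denom γ z)

lemma E2_slash_eq (γ : SL(2, ℤ)) : E2 ∣[(2 : ℤ)] γ = E2 + (12 : ℂ) • E2Cocycle γ := by
  rw [E2_slash_action]
  ext z
  simp only [Pi.sub_apply, Pi.smul_apply, Pi.add_apply, D2, E2Cocycle, smul_eq_mul,
    riemannZeta_two]
  have : (Real.pi : ℂ) ≠ 0 := by exact_mod_cast Real.pi_ne_zero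
  have := denom_ne_zero γ z
  have := Complex.I_ne_zero
  field_simp
  linear_combination (-12 * (γ 1 0 : ℂ)) * Complex.I_sq

lemma hasDerivAt_E2Cocycle (γ : SL(2, ℤ)) (z : ℍ) :
    HasDerivAt (E2Cocycle γ ∘ ofComplex)
      (-(2 * Real.pi * Complex.I)⁻¹ * (γ 1 0) ^ 2 / denom γ z ^ 2) z := by
  have h := ((hasDerivAt_denom_zpow (γ : GL (Fin 2) ℝ) (-1) z).const_mul
    ((2 * Real.pi * Complex.I)⁻¹ * (γ 1 0 : ℂ)))
  refine (h.congr_of_eventuallyEq ?_).congr_deriv ?_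
  · filter_upwards [isOpen_upperHalfPlaneSet.mem_nhds z.im_pos] with w hw
    simp [E2Cocycle, ofComplex_apply_of_im_pos hw]
    ring
  · simp
    have := denom_ne_zero γ z
    field_simp

lemma mdifferentiable_E2Cocycle (γ : SL(2, ℤ)) : MDiff (E2Cocycle γ) := fun z ↦
  mdifferentiableAt_iff.mpr (hasDerivAt_E2Cocycle γ z).differentiableAt

lemma deriv_E2Cocycle (γ : SL(2, ℤ)) : D (E2Cocycle γ) = -(E2Cocycle γ * E2Cocycle γ) := by
  ext z
  rw [Derivative.normalizedDerivOfComplex, (hasDerivAt_E2Cocycle γ z).deriv]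
  simp only [Pi.neg_apply, Pi.mul_apply, E2Cocycle]
  ring

/-- With `c` the cocycle, `E₂` transforms to `E₂ + 12c` and `D c = -c²`; all terms in `c` cancel in
this combination, which is therefore modular of weight 4. -/
lemma deriv_E2_slash (γ : SL(2, ℤ)) :
    ((12 : ℂ) • D E2 - E2 * E2) ∣[(4 : ℤ)] γ = (12 : ℂ) • D E2 - E2 * E2 := by
  have h1 := Derivative.normalizedDerivOfComplex_SL_slash (k := 2) E2_mdifferentiable (γ := γ)
  have h2 : (E2 * E2) ∣[(4 : ℤ)] γ = (E2 ∣[(2 : ℤ)] γ) * (E2 ∣[(2 : ℤ)] γ) :=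
    ModularForm.mul_slash_SL2 2 2 γ E2 E2
  rw [E2_slash_eq, Derivative.normalizedDerivOfComplex_add _ _ E2_mdifferentiable
    ((mdifferentiable_E2Cocycle γ).const_smul _),
    Derivative.normalizedDerivOfComplex_smul _ _ (mdifferentiable_E2Cocycle γ),
    deriv_E2Cocycle] at h1
  rw [E2_slash_eq] at h2
  rw [sub_eq_add_neg, SlashAction.add_slash, SlashAction.neg_slash, h2,
    ModularForm.SL_smul_slash]
  ext z
  have h3 := congrFun h1 z
  simp only [Pi.add_apply, Pi.smul_apply, Pi.neg_apply, Pi.mul_apply, Pi.sub_apply,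
    smul_eq_mul] at h3 ⊢
  have h4 : (2 : ℂ) * (2 * Real.pi * Complex.I)⁻¹ * (γ 1 0 / denom γ z) = 2 * E2Cocycle γ z := by
    rw [E2Cocycle]; ring
  push_cast at h3
  rw [h4] at h3
  linear_combination -12 * h3

/-- The `q`-expansion of `E₂`. -/
noncomputable def e2Series : PowerSeries ℤ :=
  .mk fun m ↦ if m = 0 then 1 else -24 * (ArithmeticFunction.sigma 1 m : ℤ)

/-- The `q`-expansion of `E₄`. -/
noncomputable def e4Series : PowerSeries ℤ :=
  .mk fun m ↦ if m = 0 then 1 else 240 * (ArithmeticFunction.sigma 3 m : ℤ)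

/-- The `q`-expansion of `E₆`. -/
noncomputable def e6Series : PowerSeries ℤ :=
  .mk fun m ↦ if m = 0 then 1 else -504 * (ArithmeticFunction.sigma 5 m : ℤ)

lemma coeff_zero_e2Series {S : Type*} [CommRing S] (φ : ℤ →+* S) :
    (e2Series.map φ).constantCoeff = 1 := by
  rw [← PowerSeries.coeff_zero_eq_constantCoeff_apply, PowerSeries.coeff_map, e2Series,
    PowerSeries.coeff_mk, if_pos rfl, map_one]

lemma coeff_zero_e4Series {S : Type*} [CommRing S] (φ : ℤ →+* S) :
    (e4Series.map φ).constantCoeff = 1 := by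
  rw [← PowerSeries.coeff_zero_eq_constantCoeff_apply, PowerSeries.coeff_map, e4Series,
    PowerSeries.coeff_mk, if_pos rfl, map_one]

lemma coeff_zero_e6Series {S : Type*} [CommRing S] (φ : ℤ →+* S) :
    (e6Series.map φ).constantCoeff = 1 := by
  rw [← PowerSeries.coeff_zero_eq_constantCoeff_apply, PowerSeries.coeff_map, e6Series,
    PowerSeries.coeff_mk, if_pos rfl, map_one]

lemma qExpansion_E2 : qExpansion 1 E2 = e2Series.map (Int.castRingHom ℂ) := by
  apply isHolomorphicAtCusp_E2.qExpansion_eq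
  intro τ
  have := hasSum_qExpansion_E2 (z := τ)
  simpa [e2Series, Function.Periodic.qParam, apply_ite (Int.cast (R := ℂ))] using this

lemma qExpansion_E4 : qExpansion 1 E₄ = e4Series.map (Int.castRingHom ℂ) := by
  ext m
  rw [E_qExpansion_coeff _ ⟨2, rfl⟩]
  norm_num [e4Series, apply_ite (Int.cast (R := ℂ)), show bernoulli 4 = -1 / 30 by decide +kernel]

lemma qExpansion_E6 : qExpansion 1 E₆ = e6Series.map (Int.castRingHom ℂ) := by
  ext m
  rw [E_qExpansion_coeff _ ⟨3, rfl⟩]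
  norm_num [e6Series, apply_ite (Int.cast (R := ℂ)), show bernoulli 6 = 1 / 42 by decide +kernel]

open RamanujanTriple (thetaOp)

lemma ramanujan_E2 :
    (12 : ℂ) • thetaOp (qExpansion 1 E2) - qExpansion 1 E2 * qExpansion 1 E2 = -qExpansion 1 E₄ := by
  have h2 := isHolomorphicAtCusp_E2
  have hf := (h2.deriv.const_smul 12).sub (h2.mul h2)
  have hq : qExpansion 1 ((12 : ℂ) • D E2 - E2 * E2) =
      (12 : ℂ) • thetaOp (qExpansion 1 E2) - qExpansion 1 E2 * qExpansion 1 E2 := by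
    rw [qExpansion_sub (h2.deriv.const_smul 12).analyticAt (h2.mul h2).analyticAt,
      qExpansion_smul h2.deriv.analyticAt, qExpansion_mul h2.analyticAt h2.analyticAt,
      h2.qExpansion_deriv]
  rw [← hq, ← qExpansion_neg E₄.isHolomorphicAtCusp.analyticAt]
  refine ModularForm.qExpansion_eq_of_weight_lt_twelve (k := 4) (by norm_num)
    (hf.toModularForm deriv_E2_slash) (-E₄) ?_
  change (qExpansion 1 ((12 : ℂ) • D E2 - E2 * E2)).coeff 0 = (qExpansion 1 (-(E₄ : ℍ → ℂ))).coeff 0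
  rw [hq, qExpansion_neg E₄.isHolomorphicAtCusp.analyticAt, qExpansion_E2, qExpansion_E4]
  simp [thetaOp, coeff_zero_e2Series, coeff_zero_e4Series]

/-- The Serre derivative of a modular form. -/
noncomputable def ModularForm.serreDeriv {k : ℤ} (f : ModularForm 𝒮ℒ k) : ModularForm 𝒮ℒ (k + 2) :=
  ((f.isHolomorphicAtCusp.deriv).sub
    ((isHolomorphicAtCusp_E2.mul f.isHolomorphicAtCusp).const_smul (k / 12))).toModularForm
    fun γ ↦ by
      have : D f - ((k : ℂ) / 12) • (E2 * (f : ℍ → ℂ)) = Derivative.serreDerivative k f := by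
        ext z
        simp [Derivative.serreDerivative]
        ring
      rw [this]
      exact Derivative.serreDerivative_slash_invariant (ModularFormClass.holo f)
        (SlashInvariantForm.slash_action_eqn f _ (show (γ : GL (Fin 2) ℝ) ∈ 𝒮ℒ from ⟨γ, rfl⟩))

lemma ModularForm.qExpansion_serreDeriv {k : ℤ} (f : ModularForm 𝒮ℒ k) :
    qExpansion 1 f.serreDeriv =
      thetaOp (qExpansion 1 f) - ((k : ℂ) / 12) • (qExpansion 1 E2 * qExpansion 1 f) := by
  have h2 := isHolomorphicAtCusp_E2.mul f.isHolomorphicAtCusp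
  change qExpansion 1 (D f - ((k : ℂ) / 12) • (E2 * (f : ℍ → ℂ))) = _
  rw [qExpansion_sub f.isHolomorphicAtCusp.deriv.analyticAt (h2.const_smul _).analyticAt,
    qExpansion_smul h2.analyticAt, f.isHolomorphicAtCusp.qExpansion_deriv,
    qExpansion_mul isHolomorphicAtCusp_E2.analyticAt f.isHolomorphicAtCusp.analyticAt]

lemma ramanujan_E4 : thetaOp (qExpansion 1 E₄) - (1 / 3 : ℂ) • (qExpansion 1 E2 * qExpansion 1 E₄) =
    (-1 / 3 : ℂ) • qExpansion 1 E₆ := by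
  have h := ModularForm.qExpansion_eq_of_weight_lt_twelve (k := 6) (by norm_num)
    E₄.serreDeriv ((-1 / 3 : ℂ) • E₆) ?_
  · rw [FunLike.coe_smul, ModularForm.qExpansion_smul one_pos one_mem_strictPeriods_SL] at h
    rw [← h]
    refine Eq.trans ?_ E₄.qExpansion_serreDeriv.symm
    norm_num
  · refine (congrArg (PowerSeries.coeff 0) E₄.qExpansion_serreDeriv).trans ?_
    rw [FunLike.coe_smul, ModularForm.qExpansion_smul one_pos one_mem_strictPeriods_SL,
      qExpansion_E2, qExpansion_E4, qExpansion_E6]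
    simp [RamanujanTriple.thetaOp, coeff_zero_e2Series, coeff_zero_e4Series]
    norm_num
    simpa using coeff_zero_e6Series (RingHom.id ℤ)

lemma ramanujan_E6 : thetaOp (qExpansion 1 E₆) - (1 / 2 : ℂ) • (qExpansion 1 E2 * qExpansion 1 E₆) =
    (-1 / 2 : ℂ) • qExpansion 1 E₄ ^ 2 := by
  have hq : qExpansion 1 ((-1 / 2 : ℂ) • E₄.mul E₄) = (-1 / 2 : ℂ) • qExpansion 1 E₄ ^ 2 := by
    rw [ModularForm.qExpansion_smul one_pos one_mem_strictPeriods_SL,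
      ModularForm.qExpansion_mul one_pos one_mem_strictPeriods_SL, sq]
  have h := ModularForm.qExpansion_eq_of_weight_lt_twelve (k := 8) (by norm_num)
    E₆.serreDeriv ((-1 / 2 : ℂ) • E₄.mul E₄) ?_
  · refine Eq.trans ?_ (h.trans hq)
    refine Eq.trans ?_ E₆.qExpansion_serreDeriv.symm
    norm_num
  · refine (congrArg (PowerSeries.coeff 0) E₆.qExpansion_serreDeriv).trans ?_
    refine Eq.trans ?_ (congrArg (PowerSeries.coeff 0) hq).symm
    rw [qExpansion_E2, qExpansion_E4, qExpansion_E6]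
    simp [RamanujanTriple.thetaOp, coeff_zero_e2Series, coeff_zero_e4Series,
      coeff_zero_e6Series]
    norm_num

lemma PowerSeries.X_mul_derivative_map {A B : Type*} [CommRing A] [CommRing B] (φ : A →+* B)
    (s : PowerSeries A) : X * derivative B (s.map φ) = (X * derivative A s).map φ := by
  ext n
  cases n with
  | zero => simp
  | succ n => simp [coeff_succ_X_mul, coeff_derivative]

open PowerSeries in
lemma derivative_e2Series : 12 * (X * derivative ℤ e2Series) = e2Series ^ 2 - e4Series := by
  apply map_injective (Int.castRingHom ℂ) Int.cast_injective
  have h := ramanujan_E2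
  rw [RamanujanTriple.thetaOp_apply, qExpansion_E2, qExpansion_E4, X_mul_derivative_map,
    smul_eq_C_mul, map_ofNat] at h
  rw [map_mul _ 12, map_ofNat, map_sub, map_pow]
  linear_combination h

open PowerSeries in
lemma derivative_e4Series : 3 * (X * derivative ℤ e4Series) = e2Series * e4Series - e6Series := by
  apply map_injective (Int.castRingHom ℂ) Int.cast_injective
  have h := ramanujan_E4
  rw [RamanujanTriple.thetaOp_apply, qExpansion_E2, qExpansion_E4, qExpansion_E6,
    X_mul_derivative_map, smul_eq_C_mul, smul_eq_C_mul, neg_div, map_neg] at h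
  have hc : (3 : PowerSeries ℂ) * C (1 / 3 : ℂ) = 1 := by
    rw [show (3 : PowerSeries ℂ) = C 3 from (map_ofNat _ 3).symm, ← map_mul]; simp
  rw [map_mul _ 3, map_ofNat, map_sub, map_mul _ e2Series]
  linear_combination 3 * h + (e2Series.map (Int.castRingHom ℂ) * e4Series.map (Int.castRingHom ℂ) -
    e6Series.map (Int.castRingHom ℂ)) * hc

open PowerSeries in
lemma derivative_e6Series :
    2 * (X * derivative ℤ e6Series) = e2Series * e6Series - e4Series ^ 2 := by
  apply map_injective (Int.castRingHom ℂ) Int.cast_injective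
  have h := ramanujan_E6
  rw [RamanujanTriple.thetaOp_apply, qExpansion_E2, qExpansion_E4, qExpansion_E6,
    X_mul_derivative_map, smul_eq_C_mul, smul_eq_C_mul, neg_div, map_neg] at h
  have hc : (2 : PowerSeries ℂ) * C (1 / 2 : ℂ) = 1 := by
    rw [show (2 : PowerSeries ℂ) = C 2 from (map_ofNat _ 2).symm, ← map_mul]; simp
  rw [map_mul _ 2, map_ofNat, map_sub, map_mul _ e2Series, map_pow]
  linear_combination 2 * h + (e2Series.map (Int.castRingHom ℂ) * e6Series.map (Int.castRingHom ℂ) -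
    e4Series.map (Int.castRingHom ℂ) ^ 2) * hc

/-- The Eisenstein series `E₂`, `E₄`, `E₆` over a field of characteristic different from `2`, `3`. -/
noncomputable def eisensteinTriple (K : Type*) [Field K] (h2 : (2 : K) ≠ 0) (h3 : (3 : K) ≠ 0) :
    RamanujanTriple K where
  P := e2Series.map (Int.castRingHom K)
  Q := e4Series.map (Int.castRingHom K)
  R := e6Series.map (Int.castRingHom K)
  derivative_P := by
    simpa [PowerSeries.X_mul_derivative_map, map_ofNat (PowerSeries.map _)] using
      congrArg (PowerSeries.map (Int.castRingHom K)) derivative_e2Series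
  derivative_Q := by
    simpa [PowerSeries.X_mul_derivative_map, map_ofNat (PowerSeries.map _)] using
      congrArg (PowerSeries.map (Int.castRingHom K)) derivative_e4Series
  derivative_R := by
    simpa [PowerSeries.X_mul_derivative_map, map_ofNat (PowerSeries.map _)] using
      congrArg (PowerSeries.map (Int.castRingHom K)) derivative_e6Series
  coeff_zero_P := coeff_zero_e2Series _
  coeff_zero_Q := coeff_zero_e4Series _
  coeff_zero_R := coeff_zero_e6Series _
  coeff_one_ne_zero := by
    rw [← map_pow, ← map_pow, ← map_sub, PowerSeries.coeff_map]
    have : PowerSeries.coeff 1 (e4Series ^ 3 - e6Series ^ 2) = 2 ^ 6 * 3 ^ 3 := by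
      simp [pow_succ, PowerSeries.coeff_mul, Finset.Nat.antidiagonal_succ, e4Series, e6Series,
        -PowerSeries.coeff_zero_eq_constantCoeff]
    rw [this, map_mul, map_pow, map_pow, map_ofNat, map_ofNat]
    exact mul_ne_zero (pow_ne_zero _ h2) (pow_ne_zero _ h3)
  two_ne_zero := h2
  three_ne_zero := h3

/-! ### Generation of level-one modular forms by `E₄` and `E₆` -/

/-- The functions spanned by the monomials of weight `2 * k` in `E₄` and `E₆`. -/
noncomputable def eisensteinSpan (k : ℕ) : Submodule ℂ (ℍ → ℂ) :=
  Submodule.span ℂ {g | ∃ a b : ℕ, 2 * a + 3 * b = k ∧ g = (E₄ : ℍ → ℂ) ^ a * (E₆ : ℍ → ℂ) ^ b}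

lemma discriminant_mul_mem_eisensteinSpan {k : ℕ} {h : ℍ → ℂ} (hh : h ∈ eisensteinSpan k) :
    ModularForm.discriminant * h ∈ eisensteinSpan (k + 6) := by
  induction hh using Submodule.span_induction with
  | zero => simp
  | add x y _ _ hx hy => rw [mul_add]; exact add_mem hx hy
  | smul c x _ hx => rw [mul_smul_comm]; exact Submodule.smul_mem _ c hx
  | mem x hx =>
    obtain ⟨a, b, hab, rfl⟩ := hx
    have : ModularForm.discriminant * ((E₄ : ℍ → ℂ) ^ a * (E₆ : ℍ → ℂ) ^ b) =
        (1 / 1728 : ℂ) • ((E₄ : ℍ → ℂ) ^ (a + 3) * (E₆ : ℍ → ℂ) ^ b -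
          (E₄ : ℍ → ℂ) ^ a * (E₆ : ℍ → ℂ) ^ (b + 2)) := by
      ext z
      simp only [Pi.mul_apply, Pi.pow_apply, Pi.smul_apply, Pi.sub_apply, smul_eq_mul,
        ModularForm.discriminant_eq_E₄_cube_sub_E₆_sq]
      ring
    rw [this]
    exact Submodule.smul_mem _ _ (sub_mem (Submodule.subset_span ⟨_, _, by omega, rfl⟩)
      (Submodule.subset_span ⟨_, _, by omega, rfl⟩))

/-- Modular forms of level one are polynomials in `E₄` and `E₆`. -/
theorem ModularForm.mem_eisensteinSpan {k : ℕ} {w : ℤ} (hw : w = 2 * k) (f : ModularForm 𝒮ℒ w) :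
    (f : ℍ → ℂ) ∈ eisensteinSpan k := by
  induction k using Nat.strong_induction_on generalizing w with | _ k ih =>
  obtain rfl | rfl | hk : k = 0 ∨ k = 1 ∨ 2 ≤ k := by omega
  · obtain rfl : w = 0 := by simpa using hw
    obtain ⟨c, hc⟩ := ModularFormClass.levelOne_weight_zero_const f
    have : (f : ℍ → ℂ) = c • ((E₄ : ℍ → ℂ) ^ 0 * (E₆ : ℍ → ℂ) ^ 0) := by
      rw [hc]; ext z; simp
    rw [this]
    exact Submodule.smul_mem _ _ (Submodule.subset_span ⟨0, 0, rfl, rfl⟩)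
  · obtain rfl : w = 2 := by simpa using hw
    rw [rank_zero_iff_forall_zero.mp levelOne_weight_two_rank_zero f]
    exact zero_mem _
  -- A monomial of half-weight `k` has constant term 1; subtracting a multiple leaves a cusp form,
  -- which is then divided by the discriminant.
  · obtain ⟨a, b, hab⟩ : ∃ a b : ℕ, 2 * a + 3 * b = k :=
      ⟨(k - 3 * (k % 2)) / 2, k % 2, by omega⟩
    let m : ModularForm 𝒮ℒ w := ModularForm.mcast (by push_cast [← hab] at hw; rw [hw]; ring)
      ((E₄.pow a).mul (E₆.pow b))
    have hm : (m : ℍ → ℂ) = (E₄ : ℍ → ℂ) ^ a * (E₆ : ℍ → ℂ) ^ b := by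
      ext z
      simp [m]
    have hm0 : (qExpansion 1 m).coeff 0 = 1 := by
      rw [hm, qExpansion_mul (E₄.isHolomorphicAtCusp.pow a).analyticAt
        (E₆.isHolomorphicAtCusp.pow b).analyticAt, E₄.isHolomorphicAtCusp.qExpansion_pow,
        E₆.isHolomorphicAtCusp.qExpansion_pow, qExpansion_E4, qExpansion_E6]
      simp [coeff_zero_e4Series, coeff_zero_e6Series]
    set c := (qExpansion 1 f).coeff 0 with hc
    have hg : (qExpansion 1 (f - c • m)).coeff 0 = 0 := by
      rw [qExpansion_sub f.isHolomorphicAtCusp.analyticAt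
        (m.isHolomorphicAtCusp.const_smul c).analyticAt,
        qExpansion_smul m.isHolomorphicAtCusp.analyticAt, map_sub, PowerSeries.coeff_smul, hm0]
      simp [hc]
    have hfac := discriminant_mul_discriminantEquiv (toCuspForm (f - c • m) hg)
    set h := CuspForm.discriminantEquiv (toCuspForm (f - c • m) hg)
    have hmem : ModularForm.discriminant * (h : ℍ → ℂ) ∈ eisensteinSpan k := by
      by_cases hk6 : k < 6
      · rw [ModularFormClass.levelOne_neg_weight_eq_zero (by omega) h, mul_zero]
        exact zero_mem _
      · have := discriminant_mul_mem_eisensteinSpan (ih (k - 6) (by omega) (by omega) h)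
        rwa [Nat.sub_add_cancel (by omega)] at this
    have hf : (f : ℍ → ℂ) = ModularForm.discriminant * (h : ℍ → ℂ) +
        c • ((E₄ : ℍ → ℂ) ^ a * (E₆ : ℍ → ℂ) ^ b) := by
      rw [hfac, ← hm]
      ext z
      change f z = (f z - c * m z) + c * m z
      ring
    rw [hf]
    exact add_mem hmem (Submodule.smul_mem _ _ (Submodule.subset_span ⟨a, b, hab, rfl⟩))

/-! ### The monomial basis and its coefficient matrix -/

/-- Expansions of the monomials of weight `2 * k` in `E₂`, `E₄`, `E₆` of degree at most one in `E₂`,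
indexed by the degree `b` in `E₆`. -/
noncomputable def monomialSeries (k b : ℕ) : PowerSeries ℤ :=
  e2Series ^ ((k - 3 * b) % 2) * e4Series ^ ((k - 3 * b) / 2) * e6Series ^ b

/-- The monomials of weight `2 * k` in `E₂`, `E₄`, `E₆` of degree at most one in `E₂`, indexed by the
degree `b` in `E₆`. -/
noncomputable def monomialFun (k b : ℕ) : ℍ → ℂ :=
  E2 ^ ((k - 3 * b) % 2) * (E₄ : ℍ → ℂ) ^ ((k - 3 * b) / 2) * (E₆ : ℍ → ℂ) ^ b

lemma isHolomorphicAtCusp_monomialFun (k b : ℕ) : IsHolomorphicAtCusp (monomialFun k b) :=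
  ((isHolomorphicAtCusp_E2.pow _).mul (E₄.isHolomorphicAtCusp.pow _)).mul
    (E₆.isHolomorphicAtCusp.pow _)

lemma qExpansion_monomialFun (k b : ℕ) :
    qExpansion 1 (monomialFun k b) = (monomialSeries k b).map (Int.castRingHom ℂ) := by
  have h2 := isHolomorphicAtCusp_E2
  have h4 := E₄.isHolomorphicAtCusp
  have h6 := E₆.isHolomorphicAtCusp
  rw [monomialFun, qExpansion_mul ((h2.pow _).mul (h4.pow _)).analyticAt (h6.pow _).analyticAt,
    qExpansion_mul (h2.pow _).analyticAt (h4.pow _).analyticAt, h2.qExpansion_pow,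
    h4.qExpansion_pow, h6.qExpansion_pow, qExpansion_E2, qExpansion_E4, qExpansion_E6,
    monomialSeries]
  simp only [map_mul, map_pow]

lemma mem_quasimodularForms {w r : ℤ} {l : ℕ} (hl : (l : ℤ) ≤ r) (g : ModularForm 𝒮ℒ (w - 2 * l)) :
    E2 ^ l * (g : ℍ → ℂ) ∈ quasimodularForms w r :=
  Submodule.subset_span ⟨l, g, hl, rfl⟩

lemma monomialFun_mem (k : ℕ) {b : ℕ} (hb : 3 * b ≤ k) :
    monomialFun k b ∈ quasimodularForms (2 * k) 1 := by
  have h := mem_quasimodularForms (w := 2 * k) (r := 1) (l := (k - 3 * b) % 2) (by omega)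
    (ModularForm.mcast (by push_cast; omega) ((E₄.pow ((k - 3 * b) / 2)).mul (E₆.pow b)))
  rwa [ModularForm.coe_mcast, ModularForm.coe_mul, ModularForm.coe_pow, ModularForm.coe_pow,
    ← mul_assoc] at h

/-- Monomials in `E₂`, `E₄`, `E₆` span the quasimodular forms of depth at most one. -/
theorem quasimodularForms_eq_span (k : ℕ) : quasimodularForms (2 * k) 1 =
    Submodule.span ℂ (Set.range fun b : Fin (k / 3 + 1) ↦ monomialFun k b) := by
  apply le_antisymm
  · apply Submodule.span_le.mpr
    rintro _ ⟨l, g, hl, rfl⟩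
    suffices h : ∀ j : ℕ, j + l = k → ∀ x ∈ eisensteinSpan j, E2 ^ l * x ∈
        Submodule.span ℂ (Set.range fun b : Fin (k / 3 + 1) ↦ monomialFun k b) by
      by_cases hlk : l ≤ k
      · exact h (k - l) (by omega) _ (ModularForm.mem_eisensteinSpan (by omega) g)
      · rw [ModularFormClass.levelOne_neg_weight_eq_zero (by omega) g, mul_zero]
        exact zero_mem _
    intro j hj x hx
    induction hx using Submodule.span_induction with
    | zero => simp
    | add x y _ _ hx hy => rw [mul_add]; exact add_mem hx hy
    | smul c x _ hx => rw [mul_smul_comm]; exact Submodule.smul_mem _ c hx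
    | mem x hx =>
      obtain ⟨a, b, hab, rfl⟩ := hx
      refine Submodule.subset_span ⟨⟨b, by omega⟩, ?_⟩
      simp only [monomialFun]
      rw [show (k - 3 * b) % 2 = l by omega, show (k - 3 * b) / 2 = a by omega, mul_assoc]
  · apply Submodule.span_le.mpr
    rintro _ ⟨b, rfl⟩
    exact monomialFun_mem k (by omega)

/-- The leading Fourier coefficients of the monomial basis. -/
noncomputable def coeffMatrix (k : ℕ) : Matrix (Fin (k / 3 + 1)) (Fin (k / 3 + 1)) ℤ :=
  .of fun n b ↦ (monomialSeries k b).coeff n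

lemma det_coeffMatrix_of_lt {k : ℕ} (hk : k < 3) : (coeffMatrix k).det = 1 := by
  have : k / 3 = 0 := Nat.div_eq_of_lt hk
  have : Subsingleton (Fin (k / 3 + 1)) := by
    rw [this]; exact inferInstanceAs (Subsingleton (Fin 1))
  have e2 := coeff_zero_e2Series (RingHom.id ℤ)
  have e4 := coeff_zero_e4Series (RingHom.id ℤ)
  simp only [PowerSeries.map_id, id_eq] at e2 e4
  rw [Matrix.det_eq_elem_of_subsingleton _ 0, coeffMatrix, Matrix.of_apply, Fin.val_zero,
    PowerSeries.coeff_zero_eq_constantCoeff_apply, monomialSeries]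
  simp [e2, e4]

open MvPolynomial RamanujanTriple in
/-- The matrix of leading coefficients is invertible in characteristic zero and in characteristic
greater than `max 3 (2 * k - 1)`. -/
theorem det_coeffMatrix_ne_zero {K : Type*} [Field K] (h2 : (2 : K) ≠ 0) (h3 : (3 : K) ≠ 0)
    {m : ℕ} (hchar : ∀ i : ℕ, 1 ≤ i → i ≤ 2 * m + 1 → (i : K) ≠ 0) :
    ((coeffMatrix (m + 1)).det : K) ≠ 0 := by
  classical
  set k := m + 1 with hk
  rw [← eq_intCast (Int.castRingHom K), RingHom.map_det]
  intro h0
  obtain ⟨v, hv0, hv⟩ := Matrix.exists_mulVec_eq_zero_iff.mpr h0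
  let T := eisensteinTriple K h2 h3
  let expo (b : ℕ) : Fin 2 →₀ ℕ := Finsupp.single 0 ((k - 3 * b) / 2) + Finsupp.single 1 b
  have hexpo (b : ℕ) : Finsupp.weight halfWeight (expo b) = 2 * ((k - 3 * b) / 2) + 3 * b := by
    simp [expo, Finsupp.weight_single, mul_comm]
  have hinj (b b' : Fin (k / 3 + 1)) (h : expo b = expo b') : b = b' := by
    have := DFunLike.congr_fun h 1
    simpa [expo, Fin.ext_iff] using this
  -- `F r` is the coefficient of `E₂^r` in the combination given by the kernel vector `v`.
  let F (r : ℕ) : MvPolynomial (Fin 2) K :=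
    ∑ b : Fin (k / 3 + 1), monomial (expo b) (if (k - 3 * b) % 2 = r then v b else 0)
  have hF (r : ℕ) : IsForm (F r) (k - r) := by
    refine IsWeightedHomogeneous.sum _ _ _ fun b _ ↦ ?_
    split_ifs with hb
    · apply isWeightedHomogeneous_monomial
      rw [hexpo]
      omega
    · simpa using isWeightedHomogeneous_zero _ _ _
  have hcoeff (r : ℕ) (b : Fin (k / 3 + 1)) :
      coeff (expo b) (F r) = if (k - 3 * b) % 2 = r then v b else 0 := by
    simp only [F, coeff_sum, coeff_monomial]
    rw [Finset.sum_eq_single b (fun b' _ hb' ↦ if_neg fun h ↦ hb' (hinj _ _ h)) (by simp),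
      if_pos rfl]
  have hexp (b : ℕ) (c : K) : T.expansion (monomial (expo b) c) =
      PowerSeries.C c * (T.Q ^ ((k - 3 * b) / 2) * T.R ^ b) := by
    have : monomial (expo b) c = C c * (X 0 ^ ((k - 3 * b) / 2) * X 1 ^ b) := by
      rw [X_pow_eq_monomial, X_pow_eq_monomial, monomial_mul, C_mul_monomial]
      simp [expo]
    rw [this]
    simp
  have hsum : T.expansion (F 0) + T.P * T.expansion (F 1) =
      ∑ b : Fin (k / 3 + 1), PowerSeries.C (v b) *
        (monomialSeries k b).map (Int.castRingHom K) := by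
    simp only [F, map_sum, hexp, Finset.mul_sum]
    rw [← Finset.sum_add_distrib]
    refine Finset.sum_congr rfl fun b _ ↦ ?_
    simp only [monomialSeries, map_mul, map_pow, T, eisensteinTriple]
    rcases Nat.mod_two_eq_zero_or_one (k - 3 * b) with h | h <;> simp [h]
    ring
  obtain ⟨hA, hB⟩ := T.eq_zero_of_dvd_quasimodular (A := F 0) (B := F 1) (m := m)
    (n := k / 3 + 1) (hF 0) (hF 1) (by omega) (by
      rw [PowerSeries.X_pow_dvd_iff, hsum]
      intro n hn
      have := congrFun hv ⟨n, hn⟩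
      simp only [Matrix.mulVec, dotProduct, Pi.zero_apply] at this
      rw [map_sum, ← this]
      refine Finset.sum_congr rfl fun b _ ↦ ?_
      rw [PowerSeries.coeff_C_mul, PowerSeries.coeff_map, mul_comm]
      rfl) hchar
  apply hv0
  ext b
  have hA' := hcoeff 0 b
  have hB' := hcoeff 1 b
  rw [hA, coeff_zero] at hA'
  rw [hB, coeff_zero] at hB'
  rcases Nat.mod_two_eq_zero_or_one (k - 3 * b) with h | h
  · rw [if_pos h] at hA'; exact hA'.symm
  · rw [if_pos h] at hB'; exact hB'.symm

lemma det_coeffMatrix_ne_zero_int (k : ℕ) : (coeffMatrix k).det ≠ 0 := by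
  cases k with
  | zero => rw [det_coeffMatrix_of_lt (by norm_num)]; exact one_ne_zero
  | succ m =>
    have := det_coeffMatrix_ne_zero (K := ℚ) (m := m) (by norm_num) (by norm_num)
      fun i hi _ ↦ by exact_mod_cast (by omega)
    exact_mod_cast this

/-- All prime factors of the determinant of the leading coefficients are less than the weight. -/
lemma lt_of_prime_dvd_det {k p : ℕ} (hp : p.Prime) (h : (p : ℤ) ∣ (coeffMatrix k).det) :
    p < 2 * k := by
  by_contra hlt
  -- For `k ≥ 3`, `p ≥ 2k` makes 2 and 3 invertible modulo `p`. For smaller `k` this can fail, but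
  -- the matrix is then `1 × 1` with entry 1.
  rcases lt_or_ge k 3 with hk | hk
  · rw [det_coeffMatrix_of_lt hk] at h
    exact hp.one_lt.ne' (by exact_mod_cast Int.eq_one_of_dvd_one (by positivity) h)
  · obtain ⟨m, rfl⟩ : ∃ m, k = m + 1 := ⟨k - 1, by omega⟩
    have := Fact.mk hp
    have hchar (i : ℕ) (h1 : 1 ≤ i) (h2 : i < p) : (i : ZMod p) ≠ 0 := by
      rw [Ne, ZMod.natCast_eq_zero_iff]
      exact Nat.not_dvd_of_pos_of_lt h1 h2
    refine det_coeffMatrix_ne_zero (K := ZMod p) (m := m) ?_ ?_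
      (fun i h1 h2 ↦ hchar i h1 (by omega)) ((ZMod.intCast_zmod_eq_zero_iff_dvd _ _).mpr h)
    · exact_mod_cast hchar 2 (by norm_num) (by omega)
    · exact_mod_cast hchar 3 (by norm_num) (by omega)

lemma isHolomorphicAtCusp_sum_monomialFun (k : ℕ) (x : Fin (k / 3 + 1) → ℂ) :
    IsHolomorphicAtCusp (∑ b, x b • monomialFun k b) ∧
      qExpansion 1 (∑ b, x b • monomialFun k b) =
        ∑ b : Fin (k / 3 + 1), x b • (monomialSeries k b).map (Int.castRingHom ℂ) := by
  have := IsHolomorphicAtCusp.sum_smul Finset.univ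
    (fun b : Fin (k / 3 + 1) ↦ isHolomorphicAtCusp_monomialFun k b) x
  simpa only [qExpansion_monomialFun] using this

lemma fourierCoeff₁_sum_monomialFun (k : ℕ) (x : Fin (k / 3 + 1) → ℂ) (n : ℕ) :
    fourierCoeff₁ (∑ b, x b • monomialFun k b) n =
      ∑ b : Fin (k / 3 + 1), ((monomialSeries k b).coeff n : ℂ) * x b := by
  rw [fourierCoeff₁, (isHolomorphicAtCusp_sum_monomialFun k x).2, map_sum]
  refine Finset.sum_congr rfl fun b _ ↦ ?_
  rw [PowerSeries.coeff_smul, PowerSeries.coeff_map, smul_eq_mul, mul_comm]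
  rfl

/-- The leading coefficients of a quasimodular form in terms of its coordinates. -/
lemma mulVec_coeffMatrix (k : ℕ) (x : Fin (k / 3 + 1) → ℂ) :
    ((coeffMatrix k).map (Int.castRingHom ℂ)).mulVec x =
      fun n : Fin (k / 3 + 1) ↦ fourierCoeff₁ (∑ b, x b • monomialFun k b) n := by
  ext n
  rw [fourierCoeff₁_sum_monomialFun]
  rfl

lemma det_coeffMatrix_complex (k : ℕ) :
    ((coeffMatrix k).map (Int.castRingHom ℂ)).det = ((coeffMatrix k).det : ℂ) :=
  (RingHom.map_det (Int.castRingHom ℂ) _).symm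

lemma isUnit_det_coeffMatrix (k : ℕ) :
    IsUnit ((coeffMatrix k).map (Int.castRingHom ℂ)).det := by
  rw [det_coeffMatrix_complex]
  exact (Int.cast_ne_zero.mpr (det_coeffMatrix_ne_zero_int k)).isUnit

lemma linearIndependent_monomialFun (k : ℕ) :
    LinearIndependent ℂ fun b : Fin (k / 3 + 1) ↦ monomialFun k b := by
  rw [Fintype.linearIndependent_iff]
  intro x hx
  have h := mulVec_coeffMatrix k x
  rw [hx] at h
  have h0 : ((coeffMatrix k).map (Int.castRingHom ℂ)).mulVec x = 0 := by
    rw [h]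
    ext n
    simp [fourierCoeff₁, qExpansion_zero]
  exact congrFun (Matrix.eq_zero_of_mulVec_eq_zero (isUnit_det_coeffMatrix k).ne_zero h0)

/-- The dimension of the space of quasimodular forms of depth at most one. -/
theorem finrank_quasimodularForms (k : ℕ) :
    Module.finrank ℂ (quasimodularForms (2 * k) 1) = k / 3 + 1 := by
  rw [quasimodularForms_eq_span, finrank_span_eq_card (linearIndependent_monomialFun k),
    Fintype.card_fin]

lemma exists_eq_sum_monomialFun {k : ℕ} {G : ℍ → ℂ} (hG : G ∈ quasimodularForms (2 * k) 1) :
    ∃ x : Fin (k / 3 + 1) → ℂ, G = ∑ b, x b • monomialFun k b := by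
  rw [quasimodularForms_eq_span, Submodule.mem_span_range_iff_exists_fun] at hG
  obtain ⟨x, hx⟩ := hG
  exact ⟨x, hx.symm⟩

/-! ### Extremal forms: existence, uniqueness, denominators -/

/-- The coordinates of a normalized extremal quasimodular form solve a linear system. -/
lemma IsNormalizedExtremalQuasimodular.mulVec_eq {k : ℕ} {x : Fin (k / 3 + 1) → ℂ}
    (h : IsNormalizedExtremalQuasimodular (2 * k) 1 (∑ b, x b • monomialFun k b)) :
    ((coeffMatrix k).map (Int.castRingHom ℂ)).mulVec x = Pi.single (Fin.last _) 1 := by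
  obtain ⟨⟨-, -, hord⟩, hlead⟩ := h
  rw [finrank_quasimodularForms, Nat.add_sub_cancel] at hord hlead
  rw [mulVec_coeffMatrix]
  ext n
  rcases eq_or_ne n (Fin.last _) with rfl | hn
  · rw [Pi.single_eq_same, Fin.val_last, hlead]
  · rw [Pi.single_eq_of_ne hn]
    apply PowerSeries.coeff_of_lt_order
    rw [hord, Nat.cast_lt]
    exact Fin.val_lt_last hn

lemma eq_of_isNormalizedExtremalQuasimodular {k : ℕ} {G G' : ℍ → ℂ}
    (h : IsNormalizedExtremalQuasimodular (2 * k) 1 G)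
    (h' : IsNormalizedExtremalQuasimodular (2 * k) 1 G') : G = G' := by
  obtain ⟨x, rfl⟩ := exists_eq_sum_monomialFun h.1.1
  obtain ⟨x', rfl⟩ := exists_eq_sum_monomialFun h'.1.1
  rw [Matrix.mulVec_injective_of_isUnit ((Matrix.isUnit_iff_isUnit_det _).mpr
    (isUnit_det_coeffMatrix k)) (h.mulVec_eq.trans h'.mulVec_eq.symm)]

/-- Forms of depth zero are modular forms. -/
lemma exists_modularForm_of_mem {w : ℤ} {f : ℍ → ℂ} (hf : f ∈ quasimodularForms w 0) :
    ∃ g : ModularForm 𝒮ℒ w, (g : ℍ → ℂ) = f := by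
  induction hf using Submodule.span_induction with
  | zero => exact ⟨0, rfl⟩
  | add x y _ _ hx hy =>
    obtain ⟨a, rfl⟩ := hx
    obtain ⟨b, rfl⟩ := hy
    exact ⟨a + b, rfl⟩
  | smul c x _ hx =>
    obtain ⟨a, rfl⟩ := hx
    exact ⟨c • a, rfl⟩
  | mem x hx =>
    obtain ⟨l, g, hl, rfl⟩ := hx
    obtain rfl : l = 0 := by omega
    exact ⟨ModularForm.mcast (by simp) g, by simp⟩

lemma exists_isNormalizedExtremalQuasimodular {k : ℕ} (h1 : 1 ≤ k) (h2 : k ≠ 2) :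
    ∃ G, IsNormalizedExtremalQuasimodular (2 * k) 1 G := by
  set A := (coeffMatrix k).map (Int.castRingHom ℂ)
  set x : Fin (k / 3 + 1) → ℂ := A⁻¹.mulVec (Pi.single (Fin.last _) 1) with hx
  have hAx : A.mulVec x = Pi.single (Fin.last _) 1 := by
    rw [hx, Matrix.mulVec_mulVec, Matrix.mul_nonsing_inv _ (isUnit_det_coeffMatrix k),
      Matrix.one_mulVec]
  rw [mulVec_coeffMatrix] at hAx
  set G := ∑ b, x b • monomialFun k b with hG
  have hlead : fourierCoeff₁ G (k / 3) = 1 := by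
    simpa using congrFun hAx (Fin.last _)
  have hord : (qExpansion 1 G).order = (k / 3 : ℕ) := by
    refine PowerSeries.order_eq_nat.mpr ⟨?_, fun i hi ↦ ?_⟩
    · exact ne_of_eq_of_ne hlead one_ne_zero
    · have := congrFun hAx ⟨i, by omega⟩
      rwa [Pi.single_eq_of_ne (by simp [Fin.ext_iff]; omega)] at this
  refine ⟨G, ⟨?_, ?_, ?_⟩, ?_⟩
  · rw [quasimodularForms_eq_span, Submodule.mem_span_range_iff_exists_fun]
    exact ⟨x, rfl⟩
  · rw [sub_self]
    intro hmem
    obtain ⟨g, hg⟩ := exists_modularForm_of_mem hmem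
    have hne : G ≠ 0 := by
      rintro h0
      rw [h0] at hlead
      simp [fourierCoeff₁, qExpansion_zero] at hlead
    apply hne
    rw [← hg] at hord ⊢
    -- A modular form of weight `2k` and order `k/3` would exceed the Sturm bound `⌊k/6⌋` once `k ≥
    -- 3`; in weight 2 there are none at all.
    obtain rfl | hk : k = 1 ∨ 3 ≤ k := by omega
    · rw [rank_zero_iff_forall_zero.mp ModularForm.levelOne_weight_two_rank_zero g]
      rfl
    · rw [ModularForm.sturm_bound_levelOne (f := g) (by rw [hord, Nat.cast_lt]; omega)]
      rfl
  · rw [finrank_quasimodularForms, Nat.add_sub_cancel, hord]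
  · rw [finrank_quasimodularForms, Nat.add_sub_cancel, hlead]

/-- The determinant of the leading coefficients is a denominator of every Fourier coefficient. -/
lemma IsNormalizedExtremalQuasimodular.exists_int {k : ℕ} {G : ℍ → ℂ}
    (h : IsNormalizedExtremalQuasimodular (2 * k) 1 G) (n : ℕ) :
    ∃ z : ℤ, ((coeffMatrix k).det : ℂ) * fourierCoeff₁ G n = z := by
  obtain ⟨x, rfl⟩ := exists_eq_sum_monomialFun h.1.1
  -- Multiplying by the adjugate gives `det M · x` as a column of an integer matrix.
  have hx := congrArg
    (Matrix.adjugate ((coeffMatrix k).map (Int.castRingHom ℂ))).mulVec h.mulVec_eq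
  rw [Matrix.mulVec_mulVec, Matrix.adjugate_mul, Matrix.smul_mulVec, Matrix.one_mulVec,
    det_coeffMatrix_complex, Matrix.mulVec_single_one] at hx
  refine ⟨∑ b : Fin (k / 3 + 1), (monomialSeries k b).coeff n * (coeffMatrix k).adjugate b (Fin.last _), ?_⟩
  rw [fourierCoeff₁_sum_monomialFun, Finset.mul_sum, Int.cast_sum]
  refine Finset.sum_congr rfl fun b _ ↦ ?_
  have hb := congrFun hx b
  have hadj := RingHom.map_adjugate (Int.castRingHom ℂ) (coeffMatrix k)
  rw [RingHom.mapMatrix_apply, RingHom.mapMatrix_apply] at hadj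
  rw [← hadj] at hb
  simp only [Pi.smul_apply, smul_eq_mul, Matrix.col_apply, Matrix.map_apply, eq_intCast] at hb
  rw [mul_left_comm, hb, Int.cast_mul]

lemma quasimodularForms_eq_bot_of_odd {w r : ℤ} (hw : Odd w) : quasimodularForms w r = ⊥ := by
  rw [quasimodularForms, Submodule.span_eq_bot]
  rintro _ ⟨l, g, -, rfl⟩
  rw [ModularForm.levelOne_odd_weight_eq_zero (hw.sub_even (even_two_mul _)) g]
  simp

theorem mainTheorem5 (w : ℕ) :
    (Even w → 2 ≤ w → w ≠ 4 → ∃! G : ℍ → ℂ, IsNormalizedExtremalQuasimodular w 1 G) ∧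
    ∀ G : ℍ → ℂ, IsNormalizedExtremalQuasimodular w 1 G →
      ∀ n : ℕ, ∃ a : ℚ, fourierCoeff₁ G n = (a : ℂ) ∧
        ∀ p : ℕ, p.Prime → p ∣ a.den → p < w := by
  rcases Nat.even_or_odd w with hw | hw
  · obtain ⟨k, rfl⟩ := hw.exists_two_nsmul
    simp only [smul_eq_mul, Nat.cast_mul, Nat.cast_ofNat]
    refine ⟨fun _ h2 h4 ↦ ?_, fun G hG n ↦ ?_⟩
    · obtain ⟨G, hG⟩ := exists_isNormalizedExtremalQuasimodular (k := k) (by omega) (by omega)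
      exact ⟨G, hG, fun G' hG' ↦ eq_of_isNormalizedExtremalQuasimodular hG' hG⟩
    · obtain ⟨z, hz⟩ := hG.exists_int n
      have hdet := det_coeffMatrix_ne_zero_int k
      refine ⟨(z : ℚ) / ((coeffMatrix k).det : ℤ), ?_, fun p hp hdvd ↦ ?_⟩
      · rw [Rat.cast_div, Rat.cast_intCast, Rat.cast_intCast,
          eq_div_iff (Int.cast_ne_zero.mpr hdet), mul_comm, hz]
      · apply lt_of_prime_dvd_det hp
        rw [← Rat.divInt_eq_div] at hdvd
        exact (Int.natCast_dvd_natCast.mpr hdvd).trans (Rat.den_dvd _ _)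
  · refine ⟨fun h ↦ absurd h (Nat.not_even_iff_odd.mpr hw), fun G hG ↦ ?_⟩
    obtain ⟨⟨hmem, hnot, -⟩, -⟩ := hG
    rw [quasimodularForms_eq_bot_of_odd (by exact_mod_cast hw), Submodule.mem_bot] at hmem
    exact absurd (hmem ▸ zero_mem _) hnot
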